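/- \textbf{Setting.} Let $\sigma>0$, $\delta\in\mathbb R$, and let $\Lambda_k\subset\mathbb R^{n_k}$ ($k\ge 0$) be full-rank lattices of dimensions $n_k\ge1$ with $n_k\to\infty$, all of normalized log density $\delta$, that is, of density $\beta_k=1/\det\Lambda_k=e^{n_k\delta}$. The lattice $\Lambda_k$ is used without power restriction over the AWGN channel with noise vector $\mathbf z\sim\mathcal N(0,\sigma^2 I_{n_k})$. Its maximum-likelihood (nearest-point) decoding error probability, with ties counted as errors, is $$P_e(\Lambda_k)=\Pr\big(\exists\,\lambda\in\Lambda_k\setminus\{0\}:\ \|\mathbf z-\lambda\|\le\|\mathbf z\|\big).$$ \textbf{The factor $\alpha$.} Let $V_n$ be the volume of the unit ball of $\mathbb R^n$. For an $n$-dimensional lattice $\Lambda$ of normalized log density $\delta$ and $r>0$, call a measurable $N':\mathbb R\to[0,\infty)$ a smoothed spectrum on $(0,2re^{\delta}]$ if $$\#\{\lambda\in\Lambda\setminus\{0\}: e^{\delta}\|\lambda\|\le s\}\le\int_0^sN'(x)\,dx\qquad\text{for all }0<s\le 2re^{\delta},$$ and put $\alpha_{N'}(x)=N'(x)/(nV_nx^{n-1})$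 for $x>0$ and $\alpha_{N'}(x)=0$ for $x\le 0$. Define $$\alpha(\Lambda,r)=\inf_{N'}\ \sup_{x\le 2re^{\delta}}\alpha_{N'}(x),$$ the infimum being over the smoothed spectra on $(0,2re^\delta]$ (this is $\max_{x\le 2re^\delta}\alpha^{\rm opt}(x)$, where $\alpha^{\rm opt}$ is the optimal $\alpha_{N'}$). \textbf{The radius.} For each $k$ (with $n=n_k$, $\beta=\beta_k$, $\Lambda=\Lambda_k$) let $r_k>0$ be any one of the following: (i) a minimizer over $r>0$ of the bound $$\alpha(\Lambda,r)\,\beta V_n\int_0^rf_{\|\mathbf z\|}(\rho)\rho^n\,d\rho+\int_r^\infty f_{\|\mathbf z\|}(\rho)\,d\rho,$$ where $f_{\|\mathbf z\|}$ is the density of $\|\mathbf z\|$; (ii) a solution of $r=(\alpha(\Lambda,r)\beta V_n)^{-1/n}$, that is, a terminal radius of the iteration $r\leftarrow(\alpha(\Lambda,r)\beta V_n)^{-1/n}$; (iii) any $r\ge(\beta V_n)^{-1/n}$. Put $\alpha[k]=\alpha(\Lambda_k,r_k)$. \textbf{The exponent.} Let $\delta^*=\frac12\log\frac1{2\pi e\sigma^2}$,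 $\delta_{cr}=\frac12\log\frac1{4\pi e\sigma^2}$ and $$E_r(\delta)=\begin{cases}(\delta^*-\delta)+\frac12\log\frac e4,&\delta\le\delta_{cr},\\[2pt]\frac12\left(e^{2(\delta^*-\delta)}-2(\delta^*-\delta)-1\right),&\delta_{cr}\le\delta<\delta^*,\\[2pt]0,&\delta\ge\delta^*.\end{cases}$$ \textbf{Claim.} If $\lim_{k\to\infty}\frac1{n_k}\log\alpha[k]=0$, then the sequence achieves the error exponent $E_r(\delta)$ of the unrestricted channel: there are $\varepsilon_k\to0$ such that $$P_e(\Lambda_k)\le e^{-n_k(E_r(\delta)+\varepsilon_k)}\qquad\text{for all }k.$$ -/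

import Mathlib

open MeasureTheory ProbabilityTheory Filter Topology Set

noncomputable section

namespace LatticeExponent

/-- Euclidean `n`-space. -/
abbrev Space (n : ℕ) : Type := EuclideanSpace ℝ (Fin n)

/-- `V_n`, the volume of the unit ball of `ℝⁿ`. -/
def ballVol (n : ℕ) : ℝ := (volume (Metric.ball (0 : Space n) 1)).toReal

/-- The density `β = 1 / det Λ` of a lattice. -/
def density {n : ℕ} (L : Submodule ℤ (Space n)) : ℝ := (ZLattice.covolume L)⁻¹

/-- The normalized log density `δ` of an `n`-dimensional lattice, so that `β = e^{nδ}`. -/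
def nld {n : ℕ} (L : Submodule ℤ (Space n)) : ℝ := Real.log (density L) / n

/-! ### The channel and the error probability -/

/-- The law of the AWGN noise vector: `n` independent centred Gaussians of variance `σ²`. -/
def noise (n : ℕ) (σ : ℝ) : Measure (Space n) :=
  (Measure.pi (fun _ : Fin n => gaussianReal 0 (Real.toNNReal (σ ^ 2)))).map
    (fun v => (WithLp.toLp 2 v : Space n))

/-- The law of the norm of the noise vector, that is `f_{‖z‖}(ρ) dρ`. -/
def noiseNorm (n : ℕ) (σ : ℝ) : Measure ℝ := (noise n σ).map (fun z => ‖z‖)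

/-- The noise vectors for which some lattice point other than the transmitted one (taken to be
`0`) is at least as close to the received vector. Ties count as errors. -/
def errorEvent {n : ℕ} (L : Submodule ℤ (Space n)) : Set (Space n) :=
  {z | ∃ x ∈ L, x ≠ 0 ∧ ‖z - x‖ ≤ ‖z‖}

/-- `P_e(Λ)`, the error probability of maximum likelihood (nearest lattice point) decoding. -/
def errorProb {n : ℕ} (L : Submodule ℤ (Space n)) (σ : ℝ) : ℝ :=
  (noise n σ (errorEvent L)).toReal

/-! ### The distance spectrum and the factor `α` -/

/-- The normalized distance spectrum `N = ∑ⱼ 𝒩ⱼ δ(x - λ̃ⱼ)` as a measure on the line: a unit point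
mass at `e^δ ‖x‖` for each nonzero lattice point `x`. -/
def spectrumMeasure {n : ℕ} (L : Submodule ℤ (Space n)) : Measure ℝ :=
  Measure.sum (fun x : {x : Space n // x ∈ L ∧ x ≠ 0} =>
    Measure.dirac (Real.exp (nld L) * ‖(x : Space n)‖))

/-- `N'` is a smoothed spectrum of `L` on `(0, X]`: a nonnegative density whose mass on every
`(0, s]` with `s ≤ X` is at least that of the spectrum. -/
structure IsSmoothedSpectrum {n : ℕ} (L : Submodule ℤ (Space n)) (X : ℝ) (N' : ℝ → ℝ) :
    Prop where
  measurable : Measurable N'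
  nonneg : ∀ x, 0 ≤ N' x
  mass_le : ∀ s ∈ Ioc 0 X,
    spectrumMeasure L (Ioc 0 s) ≤ ∫⁻ x in Ioc 0 s, ENNReal.ofReal (N' x)

/-- The function `α(x) = N'(x) / (n V_n x^{n-1})` for `x > 0` and `α(x) = 0` for `x ≤ 0`. -/
def alphaFun (n : ℕ) (N' : ℝ → ℝ) (x : ℝ) : ℝ :=
  if 0 < x then N' x / (n * ballVol n * x ^ (n - 1)) else 0

/-- The factor `α = max_{x ≤ 2 r e^δ} α^opt(x)`, where `α^opt` is the `α(x)` that makes this maximum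
smallest, among those that come from a smoothed spectrum on `(0, 2 r e^δ]`. -/
def alphaOpt {n : ℕ} (L : Submodule ℤ (Space n)) (r : ℝ) : ℝ :=
  sInf {c : ℝ | ∃ N' : ℝ → ℝ, IsSmoothedSpectrum L (Real.exp (nld L) * (2 * r)) N' ∧
    IsLUB (alphaFun n N' '' Iic (Real.exp (nld L) * (2 * r))) c}

/-- The upper bound `α β V_n ∫₀^r f_{‖z‖}(ρ) ρⁿ dρ + ∫_r^∞ f_{‖z‖}(ρ) dρ` on the error probability,
as a function of `r`; the factor `α` depends on `r` too. -/
def dmhsBound {n : ℕ} (L : Submodule ℤ (Space n)) (σ r : ℝ) : ℝ :=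
  alphaOpt L r * density L * ballVol n * (∫ ρ in Ioc 0 r, ρ ^ n ∂(noiseNorm n σ)) +
    (noiseNorm n σ (Ioi r)).toReal

/-- The radii at which the factor `α` may be taken: a minimizer of the bound; a terminal radius
`r = (α β V_n)^{-1/n}` of the iteration that optimizes `r`; or the starting radius
`(β V_n)^{-1/n}` of that iteration or anything larger (more spectral elements than necessary). -/
def IsBoundRadius {n : ℕ} (L : Submodule ℤ (Space n)) (σ r : ℝ) : Prop :=
  0 < r ∧
    (IsMinOn (dmhsBound L σ) (Ioi 0) r ∨
      r = (alphaOpt L r * density L * ballVol n) ^ (-(1 / (n : ℝ))) ∨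
      (density L * ballVol n) ^ (-(1 / (n : ℝ))) ≤ r)

/-! ### The error exponent of the unrestricted channel -/

/-- `δ* = ½ log (1 / (2πeσ²))`. -/
def deltaStar (σ : ℝ) : ℝ := 1 / 2 * Real.log (1 / (2 * Real.pi * Real.exp 1 * σ ^ 2))

/-- `δ_cr = ½ log (1 / (4πeσ²))`. -/
def deltaCr (σ : ℝ) : ℝ := 1 / 2 * Real.log (1 / (4 * Real.pi * Real.exp 1 * σ ^ 2))

/-- The random coding error exponent `E_r(δ)` of the unrestricted AWGN channel. -/
def randomCodingExponent (σ δ : ℝ) : ℝ :=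
  if δ ≤ deltaCr σ then (deltaStar σ - δ) + 1 / 2 * Real.log (Real.exp 1 / 4)
  else if δ < deltaStar σ then
    (Real.exp (2 * (deltaStar σ - δ)) - 2 * (deltaStar σ - δ) - 1) / 2
  else 0

end LatticeExponent

end

/-! Smoothing only encodes counting: α(Λ, r) is the least c such that, for every ρ ≤ 2r, at most c β
V_n ρ^n nonzero lattice points have norm ≤ ρ (`countBound_of_isLUB`, `exists_isLUB_of_countBound`,
`countBound_alphaOpt`).

The union bound is taken inside a ball of radius R ≤ r. As the noise is isotropic, each pairwise
error may be rotated onto a fixed axis e, so the sum of their probabilities becomes the mean of the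
number of points of norm ≤ 2⟨z, e⟩ ≤ 2R. The counting bound replaces this number by α β times the
volume of a ball. Undoing the rotation with Lebesgue measure in place of the lattice gives α β V_n
‖z‖^n (`noise_errorEvent_le`). For R = (max(1, α) β V_n)^{-1/n} this yields P_e ≤ E[min(1,
(‖z‖/R)^n)]. All three kinds of radius satisfy R ≤ r (`one_le_of_isBoundRadius`).

A Chernoff bound (`lintegral_min_le`) turns this mean into an exponent depending on u = R²/(nσ²). By
Stirling and the subexponential growth of α, u tends to e^{2(δ* - δ)} (`tendsto_radiusRatio`), where
the best Chernoff line gives E_r(δ) (`exists_chernoff_parameters`). -/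

namespace LatticeExponent

/-! ### Gaussian noise: isotropy and exponential moments -/

instance isProbabilityMeasure_noise (n : ℕ) (σ : ℝ) : IsProbabilityMeasure (noise n σ) :=
  Measure.isProbabilityMeasure_map (by fun_prop)

/-- Dependence on `t` through `‖t‖` alone is what yields rotation invariance. -/
lemma charFun_noise (n : ℕ) (σ : ℝ) (t : Space n) :
    charFun (noise n σ) t = Complex.exp (-(σ ^ 2 * ‖t‖ ^ 2 / 2 : ℝ)) := by
  rw [noise]
  simp_rw [charFun_pi, charFun_gaussianReal, ← Complex.exp_sum, EuclideanSpace.real_norm_sq_eq]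
  congr 1
  simp [Real.coe_toNNReal _ (sq_nonneg σ), Finset.sum_div, Finset.mul_sum]

/-- The noise is invariant under rotations. -/
lemma map_noise (n : ℕ) (σ : ℝ) (T : Space n ≃ₗᵢ[ℝ] Space n) :
    (noise n σ).map T = noise n σ := by
  have : IsProbabilityMeasure ((noise n σ).map T) :=
    Measure.isProbabilityMeasure_map T.continuous.measurable.aemeasurable
  apply Measure.ext_of_charFun (E := Space n)
  ext t
  have h : charFun ((noise n σ).map T) t = charFun (noise n σ) (T.symm t) := by
    rw [charFun_apply, charFun_apply, integral_map T.continuous.measurable.aemeasurable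
      (by fun_prop)]
    congr 1 with x
    rw [← T.inner_map_map x (T.symm t), T.apply_symm_apply]
  rw [h, charFun_noise, charFun_noise, T.symm.norm_map]

lemma isOpenPosMeasure_noise (n : ℕ) {σ : ℝ} (hσ : 0 < σ) :
    (noise n σ).IsOpenPosMeasure := by
  have hv : Real.toNNReal (σ ^ 2) ≠ 0 := by
    simpa using hσ.ne'
  have h1 : (gaussianReal 0 (Real.toNNReal (σ ^ 2))).IsOpenPosMeasure :=
    (gaussianReal_absolutelyContinuous' 0 hv).isOpenPosMeasure
  exact Continuous.isOpenPosMeasure_map (PiLp.continuous_toLp 2 _)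
    (WithLp.toLp_surjective 2)

lemma integral_exp_sq_gaussianReal {v : NNReal} (hv : v ≠ 0) {s : ℝ} (hs : 2 * s * v < 1) :
    Integrable (fun x : ℝ => Real.exp (s * x ^ 2)) (gaussianReal 0 v) ∧
    ∫ x, Real.exp (s * x ^ 2) ∂(gaussianReal 0 v) = √(1 / (1 - 2 * s * v)) := by
  have hv0 : (0 : ℝ) < v := by positivity
  have key : ∀ x : ℝ, gaussianPDFReal 0 v x * Real.exp (s * x ^ 2) =
      (√(2 * Real.pi * v))⁻¹ * Real.exp (-((1 - 2 * s * v) / (2 * v)) * x ^ 2) := by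
    intro x
    rw [gaussianPDFReal, mul_assoc, ← Real.exp_add]
    congr 2
    field_simp
    ring
  have hb : 0 < (1 - 2 * s * v) / (2 * v) := by
    apply div_pos <;> linarith
  constructor
  · rw [gaussianReal_of_var_ne_zero _ hv]
    rw [integrable_withDensity_iff_integrable_smul' (measurable_gaussianPDF _ _)
      (ae_of_all _ fun x => gaussianPDF_lt_top)]
    simp_rw [toReal_gaussianPDF, smul_eq_mul, key]
    exact (integrable_exp_neg_mul_sq hb).const_mul _
  · rw [integral_gaussianReal_eq_integral_smul hv]
    simp_rw [smul_eq_mul, key]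
    rw [integral_const_mul, integral_gaussian, ← Real.sqrt_inv, ← Real.sqrt_mul (by positivity)]
    congr 1
    have : (1 - 2 * s * v : ℝ) ≠ 0 := by linarith
    field_simp

/-- The exponential moments of the squared norm of the noise. -/
lemma lintegral_exp_norm_sq_noise (n : ℕ) {σ : ℝ} (hσ : 0 < σ) {s : ℝ}
    (hs : 2 * s * σ ^ 2 < 1) :
    ∫⁻ z, ENNReal.ofReal (Real.exp (s * ‖z‖ ^ 2)) ∂(noise n σ) =
      ENNReal.ofReal (√(1 / (1 - 2 * s * σ ^ 2)) ^ n) := by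
  have hv : Real.toNNReal (σ ^ 2) ≠ 0 := by simpa using hσ.ne'
  have hc : ((Real.toNNReal (σ ^ 2) : NNReal) : ℝ) = σ ^ 2 := Real.coe_toNNReal _ (sq_nonneg σ)
  obtain ⟨hi, he⟩ := integral_exp_sq_gaussianReal hv (s := s) (by rwa [hc])
  rw [noise, lintegral_map (by fun_prop) (by fun_prop)]
  have h : ∀ v : Fin n → ℝ, Real.exp (s * ‖(WithLp.toLp 2 v : Space n)‖ ^ 2) =
      ∏ i, Real.exp (s * v i ^ 2) := by
    intro v
    rw [EuclideanSpace.real_norm_sq_eq, Finset.mul_sum, Real.exp_sum]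
  simp_rw [h]
  rw [← ofReal_integral_eq_lintegral_ofReal]
  · rw [integral_fintype_prod_eq_prod (fun _ x => Real.exp (s * x ^ 2))]
    simp [he, hc]
  · exact Integrable.fintype_prod (f := fun _ x => Real.exp (s * x ^ 2)) fun _ => hi
  · exact ae_of_all _ fun v => Finset.prod_nonneg fun i _ => (Real.exp_pos _).le

/-! ### Lattice point counts and the factor α -/

/-- The number of nonzero lattice points of norm at most `ρ`. -/
noncomputable def countLE {n : ℕ} (L : Submodule ℤ (Space n)) (ρ : ℝ) : ENNReal :=
  ∑' x : {x : Space n // x ∈ L ∧ x ≠ 0}, (Iic ρ).indicator 1 ‖(x : Space n)‖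

/-- The number of nonzero lattice points of norm `ρ ≤ X` is at most `c` times the volume of the
ball of radius `ρ`. -/
def CountBound {n : ℕ} (L : Submodule ℤ (Space n)) (X c : ℝ) : Prop :=
  ∀ ρ ∈ Ioc 0 X, countLE L ρ ≤ ENNReal.ofReal (c * ballVol n * ρ ^ n)

lemma ballVol_pos (n : ℕ) : 0 < ballVol n :=
  ENNReal.toReal_pos (Metric.measure_ball_pos volume _ one_pos).ne' measure_ball_lt_top.ne

lemma volume_closedBall (n : ℕ) (x : Space n) {ρ : ℝ} (hρ : 0 ≤ ρ) :
    volume (Metric.closedBall x ρ) = ENNReal.ofReal (ballVol n * ρ ^ n) := by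
  rw [Measure.addHaar_closedBall _ _ hρ, ballVol, mul_comm, ENNReal.ofReal_mul (by positivity),
    ENNReal.ofReal_toReal measure_ball_lt_top.ne, finrank_euclideanSpace, Fintype.card_fin]

section

variable {n : ℕ} (L : Submodule ℤ (Space n))

lemma density_pos [DiscreteTopology L] [IsZLattice ℝ L] : 0 < density L :=
  inv_pos.2 (ZLattice.covolume_pos L volume)

lemma exp_nld_pow [DiscreteTopology L] [IsZLattice ℝ L] (hn : 0 < n) :
    Real.exp (nld L) ^ n = density L := by
  rw [← Real.exp_nat_mul, nld, mul_div_cancel₀ _ (by positivity), Real.exp_log (density_pos L)]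

lemma finite_norm_le [DiscreteTopology L] (X : ℝ) :
    {x : {x : Space n // x ∈ L ∧ x ≠ 0} | ‖(x : Space n)‖ ≤ X}.Finite := by
  have h : (Metric.closedBall (0 : Space n) X ∩ (L : Set (Space n))).Finite :=
    Metric.finite_isBounded_inter_isClosed DiscreteTopology.isDiscrete
      Metric.isBounded_closedBall (AddSubgroup.isClosed_of_discrete (H := L.toAddSubgroup))
  refine Set.Finite.of_finite_image (h.subset ?_) Subtype.val_injective.injOn
  rintro _ ⟨x, hx, rfl⟩
  exact ⟨by simpa using hx, x.2.1⟩

instance countable_nonzero [DiscreteTopology L] : Countable {x : Space n // x ∈ L ∧ x ≠ 0} := by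
  have : (univ : Set {x : Space n // x ∈ L ∧ x ≠ 0}) ⊆
      ⋃ m : ℕ, {x : {x : Space n // x ∈ L ∧ x ≠ 0} | ‖(x : Space n)‖ ≤ m} := fun x _ =>
    mem_iUnion.2 (exists_nat_ge ‖(x : Space n)‖)
  rw [← countable_univ_iff]
  exact (countable_iUnion fun m : ℕ => (finite_norm_le L m).countable).mono this

lemma spectrumMeasure_Ioc [DiscreteTopology L] (s : ℝ) :
    spectrumMeasure L (Ioc 0 s) = countLE L (s / Real.exp (nld L)) := by
  rw [spectrumMeasure, Measure.sum_apply _ measurableSet_Ioc, countLE]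
  congr 1 with x
  rw [Measure.dirac_apply' _ measurableSet_Ioc]
  have hx : 0 < ‖(x : Space n)‖ := norm_pos_iff.2 x.2.2
  simp only [indicator, mem_Ioc, mem_Iic, le_div_iff₀ (Real.exp_pos (nld L)), mul_comm]
  congr 1
  simp [hx, Real.exp_pos]

lemma lintegral_pow_Ioc (hn : 0 < n) {a s : ℝ} (ha : 0 ≤ a) (hs : 0 ≤ s) :
    ∫⁻ x in Ioc 0 s, ENNReal.ofReal (a * (n * ballVol n * x ^ (n - 1))) =
      ENNReal.ofReal (a * ballVol n * s ^ n) := by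
  have hV := ballVol_pos n
  rw [← ofReal_integral_eq_lintegral_ofReal]
  · congr 1
    rw [← intervalIntegral.integral_of_le hs]
    simp_rw [← mul_assoc]
    rw [intervalIntegral.integral_const_mul, integral_pow]
    have : ((n - 1 : ℕ) : ℝ) + 1 = n := by
      rw [Nat.cast_sub hn]; simp
    have h2 : n - 1 + 1 = n := by omega
    rw [this, h2, zero_pow hn.ne']
    field_simp
    ring
  · exact (Continuous.integrableOn_Icc (by fun_prop)).mono_set Ioc_subset_Icc_self
  · refine (ae_restrict_mem measurableSet_Ioc).mono fun x hx => ?_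
    have := hx.1
    positivity

/-- A bound `c` on α(x) bounds `N'` by the density c n V_n x^{n-1}, whose integral is c V_n s^n; the
factor β comes from undoing the scaling by e^δ. -/
lemma countBound_of_isLUB [DiscreteTopology L] [IsZLattice ℝ L] (hn : 0 < n) {r c : ℝ}
    {N' : ℝ → ℝ}
    (hN : IsSmoothedSpectrum L (Real.exp (nld L) * (2 * r)) N')
    (hc : IsLUB (alphaFun n N' '' Iic (Real.exp (nld L) * (2 * r))) c) (hc0 : 0 ≤ c) :
    CountBound L (2 * r) (c * density L) := by
  intro ρ hρ
  have hκ := Real.exp_pos (nld L)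
  have hs : Real.exp (nld L) * ρ ∈ Ioc 0 (Real.exp (nld L) * (2 * r)) :=
    ⟨mul_pos hκ hρ.1, mul_le_mul_of_nonneg_left hρ.2 hκ.le⟩
  have h := hN.mass_le _ hs
  rw [spectrumMeasure_Ioc, mul_div_cancel_left₀ _ hκ.ne'] at h
  refine h.trans ?_
  have e : c * density L * ballVol n * ρ ^ n =
      c * ballVol n * (Real.exp (nld L) * ρ) ^ n := by
    rw [mul_pow, exp_nld_pow L hn]; ring
  rw [e, ← lintegral_pow_Ioc hn hc0 hs.1.le]
  refine lintegral_mono_ae ((ae_restrict_mem measurableSet_Ioc).mono fun x hx => ?_)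
  apply ENNReal.ofReal_le_ofReal
  have hle := hc.1 (mem_image_of_mem _ (mem_Iic.2 (hx.2.trans hs.2)))
  have hx0 := hx.1
  have hV := ballVol_pos n
  rw [alphaFun, if_pos hx0, div_le_iff₀ (by positivity)] at hle
  exact hle

lemma exists_isLUB_of_countBound [DiscreteTopology L] [IsZLattice ℝ L] (hn : 0 < n) {r c : ℝ}
    (hr : 0 < r) (hc0 : 0 ≤ c) (h : CountBound L (2 * r) (c * density L)) :
    ∃ N' : ℝ → ℝ, IsSmoothedSpectrum L (Real.exp (nld L) * (2 * r)) N' ∧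
      IsLUB (alphaFun n N' '' Iic (Real.exp (nld L) * (2 * r))) c := by
  have hκ := Real.exp_pos (nld L)
  have hV := ballVol_pos n
  -- The extremal spectrum has constant α(x) = c on x > 0; the `max` only matters for x < 0, where
  -- x^{n-1} may be negative.
  refine ⟨fun x => max 0 (c * (n * ballVol n * x ^ (n - 1))),
    ⟨by fun_prop, fun x => le_max_left _ _, ?_⟩, ?_⟩
  · intro s hs
    have hs' : s / Real.exp (nld L) ∈ Ioc 0 (2 * r) :=
      ⟨div_pos hs.1 hκ, (div_le_iff₀' hκ).2 hs.2⟩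
    rw [spectrumMeasure_Ioc]
    refine (h _ hs').trans ?_
    have e : c * density L * ballVol n * (s / Real.exp (nld L)) ^ n = c * ballVol n * s ^ n := by
      rw [div_pow, exp_nld_pow L hn]
      have := density_pos L
      field_simp
    rw [e, ← lintegral_pow_Ioc hn hc0 hs.1.le]
    exact lintegral_mono fun x => ENNReal.ofReal_le_ofReal (le_max_right _ _)
  · have hval : ∀ x, 0 < x →
        alphaFun n (fun x => max 0 (c * (n * ballVol n * x ^ (n - 1)))) x = c := by
      intro x hx
      rw [alphaFun, if_pos hx, max_eq_right (by positivity)]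
      field_simp
    constructor
    · rintro _ ⟨x, -, rfl⟩
      by_cases hx : 0 < x
      · exact (hval x hx).le
      · rwa [alphaFun, if_neg hx]
    · intro b hb
      have hX : 0 < Real.exp (nld L) * (2 * r) := by positivity
      rw [← hval _ hX]
      exact hb (mem_image_of_mem _ self_mem_Iic)

/-- Makes the set defining `alphaOpt` nonempty. The constant is the finite sum of ‖x‖^{-n} over
points of norm ≤ X, since a point of norm ≤ ρ contributes 1 ≤ (ρ/‖x‖)^n. -/
lemma exists_countBound [DiscreteTopology L] [IsZLattice ℝ L] (X : ℝ) :
    ∃ c : ℝ, 0 ≤ c ∧ CountBound L X (c * density L) := by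
  have hV := ballVol_pos n
  have hβ := density_pos L
  set C : ENNReal := ∑' x : {x : Space n // x ∈ L ∧ x ≠ 0},
    (Iic X).indicator (fun t => ENNReal.ofReal (t⁻¹ ^ n)) ‖(x : Space n)‖ with hC
  have hfin : C ≠ ⊤ := by
    rw [hC, tsum_eq_sum (s := (finite_norm_le L X).toFinset)]
    · refine (ENNReal.sum_lt_top.2 fun x _ => ?_).ne
      unfold indicator
      split_ifs <;> simp
    · intro x hx
      rw [indicator_of_notMem]
      simpa using hx
  refine ⟨C.toReal / (density L * ballVol n), by positivity, fun ρ hρ => ?_⟩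
  have e : C.toReal / (density L * ballVol n) * density L * ballVol n * ρ ^ n
      = C.toReal * ρ ^ n := by field_simp
  rw [e, ENNReal.ofReal_mul (by positivity), ENNReal.ofReal_toReal hfin, hC, countLE,
    ← ENNReal.tsum_mul_right]
  refine ENNReal.tsum_le_tsum fun x => ?_
  have hx : 0 < ‖(x : Space n)‖ := norm_pos_iff.2 x.2.2
  by_cases hxρ : ‖(x : Space n)‖ ≤ ρ
  · rw [indicator_of_mem (by exact hxρ), indicator_of_mem (by exact hxρ.trans hρ.2),
      ← ENNReal.ofReal_mul (by positivity), ← mul_pow]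
    rw [Pi.one_apply, ENNReal.one_le_ofReal]
    apply one_le_pow₀
    rwa [← div_eq_inv_mul, one_le_div hx]
  · rw [indicator_of_notMem (by exact hxρ)]
    exact zero_le

lemma zero_mem_lowerBounds_alpha (n : ℕ) {r : ℝ} (L : Submodule ℤ (Space n)) :
    (0 : ℝ) ∈ lowerBounds {c : ℝ | ∃ N' : ℝ → ℝ,
      IsSmoothedSpectrum L (Real.exp (nld L) * (2 * r)) N' ∧
      IsLUB (alphaFun n N' '' Iic (Real.exp (nld L) * (2 * r))) c} := by
  rintro c ⟨N', -, hc⟩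
  -- α(x) vanishes at x ≤ 0, so its supremum is nonnegative; `min 0` supplies such an x whatever the
  -- sign of r.
  have h := hc.1 (mem_image_of_mem _ (show min 0 (Real.exp (nld L) * (2 * r)) ∈ Iic _ from
    mem_Iic.2 (min_le_right _ _)))
  rwa [alphaFun, if_neg (by simp)] at h

lemma alphaOpt_nonneg (r : ℝ) : 0 ≤ alphaOpt L r :=
  Real.sInf_nonneg (zero_mem_lowerBounds_alpha n L)

lemma alphaOpt_le [DiscreteTopology L] [IsZLattice ℝ L] (hn : 0 < n) {r c : ℝ}
    (hr : 0 < r) (hc0 : 0 ≤ c) (h : CountBound L (2 * r) (c * density L)) :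
    alphaOpt L r ≤ c :=
  csInf_le ⟨0, zero_mem_lowerBounds_alpha n L⟩ (exists_isLUB_of_countBound L hn hr hc0 h)

/-- The infimum is attained: for each fixed ρ the condition on `c` is a lower bound, count/(β V_n
ρ^n) ≤ c, which passes to the infimum. -/
lemma countBound_alphaOpt [DiscreteTopology L] [IsZLattice ℝ L] (hn : 0 < n) {r : ℝ}
    (hr : 0 < r) : CountBound L (2 * r) (alphaOpt L r * density L) := by
  intro ρ hρ
  have hρ0 := hρ.1
  have hV := ballVol_pos n
  have hβ := density_pos L
  obtain ⟨c₀, hc₀, hb⟩ := exists_countBound L (2 * r)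
  have hfin : countLE L ρ ≠ ⊤ := ((hb ρ hρ).trans_lt ENNReal.ofReal_lt_top).ne
  have key : (countLE L ρ).toReal / (density L * ballVol n * ρ ^ n) ≤ alphaOpt L r := by
    refine le_csInf ⟨c₀, exists_isLUB_of_countBound L hn hr hc₀ hb⟩ ?_
    rintro c hc
    have hc0 := zero_mem_lowerBounds_alpha n L hc
    obtain ⟨N', hN, hlub⟩ := hc
    have h := countBound_of_isLUB L hn hN hlub hc0 ρ hρ
    rw [div_le_iff₀ (by positivity)]
    have := ENNReal.toReal_le_of_le_ofReal (by positivity) h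
    linarith
  rw [div_le_iff₀ (by positivity)] at key
  rw [ENNReal.le_ofReal_iff_toReal_le hfin (by have := alphaOpt_nonneg L r; positivity)]
  linarith

/-- The optimal factor does not increase immediately to the right of `r`. -/
lemma eventually_alphaOpt_le [DiscreteTopology L] [IsZLattice ℝ L] (hn : 0 < n) {r : ℝ}
    (hr : 0 < r) : ∀ᶠ r' in 𝓝[>] r, alphaOpt L r' ≤ alphaOpt L r := by
  have hV := ballVol_pos n
  have hβ := density_pos L
  have hα := alphaOpt_nonneg L r
  have hgap : ∀ᶠ r' in 𝓝[>] r, ∀ x ∈ {x : {x : Space n // x ∈ L ∧ x ≠ 0} |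
      -- Discreteness: only finitely many points have norm in (2r, 2r + 2], so r' close to r leaves
      -- all of them beyond 2r'.
      ‖(x : Space n)‖ ≤ 2 * r + 2}, 2 * r < ‖(x : Space n)‖ → 2 * r' < ‖(x : Space n)‖ := by
    rw [(finite_norm_le L (2 * r + 2)).eventually_all]
    intro x _
    by_cases hx : 2 * r < ‖(x : Space n)‖
    · filter_upwards [mem_nhdsWithin_of_mem_nhds (Iio_mem_nhds (by linarith :
        r < ‖(x : Space n)‖ / 2))] with r' hr' _
      have : r' < ‖(x : Space n)‖ / 2 := hr'
      linarith
    · exact Eventually.of_forall fun _ h => absurd h hx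
  filter_upwards [hgap, self_mem_nhdsWithin,
    mem_nhdsWithin_of_mem_nhds (Iio_mem_nhds (by linarith : r < r + 1))] with r' hg hr' hr1
  have hr' : r < r' := hr'
  have hr1 : r' < r + 1 := hr1
  refine alphaOpt_le L hn (hr.trans hr') hα fun ρ hρ => ?_
  by_cases h : ρ ≤ 2 * r
  · exact countBound_alphaOpt L hn hr ρ ⟨hρ.1, h⟩
  · push Not at h
    -- Past 2r the count stays constant while the volume bound grows.
    calc countLE L ρ ≤ countLE L (2 * r) := by
          refine ENNReal.tsum_le_tsum fun x => ?_
          by_cases hx : ‖(x : Space n)‖ ≤ ρ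
          · by_cases hx2 : ‖(x : Space n)‖ ≤ 2 * r
            · rw [indicator_of_mem (s := Iic (2 * r)) (by exact hx2)]
              exact indicator_le_self' (by simp) _
            · have := hg x (hx.trans (by linarith [hρ.2])) (not_le.1 hx2)
              have := hρ.2
              linarith
          · rw [indicator_of_notMem (by exact hx)]
            exact zero_le
      _ ≤ _ := countBound_alphaOpt L hn hr (2 * r) ⟨by linarith, le_rfl⟩
      _ ≤ _ := by
          apply ENNReal.ofReal_le_ofReal
          gcongr

end

/-! ### The union bound, by rotation and Tonelli -/

lemma norm_sub_le_norm_iff {n : ℕ} (z x : Space n) :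
    ‖z - x‖ ≤ ‖z‖ ↔ ‖x‖ ^ 2 ≤ 2 * inner ℝ z x := by
  rw [← abs_norm (z - x), ← abs_norm z, ← sq_le_sq, norm_sub_sq_real]
  constructor <;> intro h <;> linarith

/-- Rotating `x` onto the axis of the unit vector `e`. -/
lemma noise_halfspace_eq {n : ℕ} (σ R : ℝ) {e : Space n} (he : ‖e‖ = 1) {x : Space n}
    (hx : x ≠ 0) :
    noise n σ ({z | ‖x‖ ^ 2 ≤ 2 * inner ℝ z x} ∩ Metric.closedBall 0 R) =
      noise n σ ({z | ‖x‖ ≤ 2 * inner ℝ z e} ∩ Metric.closedBall 0 R) := by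
  have hx0 : 0 < ‖x‖ := norm_pos_iff.2 hx
  -- The reflection that exchanges the unit vectors e and x/‖x‖.
  set T : Space n ≃ₗᵢ[ℝ] Space n := (ℝ ∙ (e - ‖x‖⁻¹ • x))ᗮ.reflection with hT
  have hTe : T e = ‖x‖⁻¹ • x := by
    apply Submodule.reflection_sub
    rw [he, norm_smul, norm_inv, norm_norm, inv_mul_cancel₀ hx0.ne']
  have hxT : x = ‖x‖ • T e := by
    rw [hTe, smul_smul, mul_inv_cancel₀ hx0.ne', one_smul]
  have hm : MeasurableSet ({z : Space n | ‖x‖ ^ 2 ≤ 2 * inner ℝ z x} ∩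
      Metric.closedBall 0 R) :=
    (measurableSet_le (by fun_prop) (by fun_prop)).inter Metric.isClosed_closedBall.measurableSet
  conv_lhs => rw [← map_noise n σ T, Measure.map_apply T.continuous.measurable hm]
  congr 1
  ext z
  have h : inner ℝ (T z) x = ‖x‖ * inner ℝ z e := by
    conv_lhs => rw [hxT]
    rw [inner_smul_right, T.inner_map_map]
  simp only [mem_preimage, mem_inter_iff, mem_ofPred_eq, mem_closedBall_zero_iff, T.norm_map, h]
  refine and_congr_left fun _ => ⟨fun h => ?_, fun h => ?_⟩ <;> nlinarith

lemma noise_halfspace_le {n : ℕ} (σ R : ℝ) {e : Space n} (he : ‖e‖ = 1) (x : Space n) :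
    noise n σ ({z | ‖x‖ ≤ 2 * inner ℝ z e} ∩ Metric.closedBall 0 R) ≤
      noise n σ ({z | ‖x‖ ^ 2 ≤ 2 * inner ℝ z x} ∩ Metric.closedBall 0 R) := by
  rcases eq_or_ne x 0 with rfl | hx
  · apply measure_mono
    rintro z ⟨-, hz⟩
    exact ⟨by simp, hz⟩
  · exact (noise_halfspace_eq σ R he hx).ge

/-- The rotation step run backwards, averaged over Lebesgue-distributed x. The z-section of ‖x‖² ≤
2⟨z, x⟩ is the ball of centre z and radius ‖z‖, of volume V_n ‖z‖^n. -/
lemma lintegral_volume_closedBall_le {n : ℕ} (σ R : ℝ) {e : Space n} (he : ‖e‖ = 1) :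
    ∫⁻ z in Metric.closedBall (0 : Space n) R,
        volume (Metric.closedBall (0 : Space n) (2 * inner ℝ z e)) ∂(noise n σ) ≤
      ∫⁻ z in Metric.closedBall (0 : Space n) R, ENNReal.ofReal (ballVol n * ‖z‖ ^ n)
        ∂(noise n σ) := by
  set μ := (noise n σ).restrict (Metric.closedBall (0 : Space n) R)
  have h1 : MeasurableSet {p : Space n × Space n | ‖p.2‖ ≤ 2 * inner ℝ p.1 e} :=
    measurableSet_le (by fun_prop) (by fun_prop)
  have h2 : MeasurableSet {p : Space n × Space n | ‖p.2‖ ^ 2 ≤ 2 * inner ℝ p.1 p.2} :=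
    measurableSet_le (by fun_prop) (by fun_prop)
  calc ∫⁻ z, volume (Metric.closedBall (0 : Space n) (2 * inner ℝ z e)) ∂μ
      = (μ.prod volume) {p : Space n × Space n | ‖p.2‖ ≤ 2 * inner ℝ p.1 e} := by
        rw [Measure.prod_apply h1]
        refine lintegral_congr fun z => ?_
        congr 1
        ext x
        simp
    _ ≤ (μ.prod volume) {p : Space n × Space n | ‖p.2‖ ^ 2 ≤ 2 * inner ℝ p.1 p.2} := by
        rw [Measure.prod_apply_symm h1, Measure.prod_apply_symm h2]
        refine lintegral_mono fun x => ?_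
        rw [Measure.restrict_apply (h1.preimage (by fun_prop)),
          Measure.restrict_apply (h2.preimage (by fun_prop))]
        exact noise_halfspace_le σ R he x
    _ = ∫⁻ z, ENNReal.ofReal (ballVol n * ‖z‖ ^ n) ∂μ := by
        rw [Measure.prod_apply h2]
        refine lintegral_congr fun z => ?_
        rw [← volume_closedBall n z (norm_nonneg z)]
        congr 1
        ext x
        rw [Metric.mem_closedBall, dist_comm, dist_eq_norm, norm_sub_le_norm_iff]
        rfl

lemma noise_errorEvent_le {n : ℕ} (L : Submodule ℤ (Space n)) [DiscreteTopology L]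
    [IsZLattice ℝ L] (hn : 0 < n) (σ : ℝ) {R c : ℝ} (hc : 0 ≤ c) (h : CountBound L (2 * R) c) :
    noise n σ (errorEvent L) ≤
      ∫⁻ z in Metric.closedBall (0 : Space n) R, ENNReal.ofReal (c * (ballVol n * ‖z‖ ^ n))
        ∂(noise n σ) + noise n σ (Metric.closedBall 0 R)ᶜ := by
  set e : Space n := EuclideanSpace.single (⟨0, hn⟩ : Fin n) (1 : ℝ)
  have he : ‖e‖ = 1 := by simp [e]
  have hsub : errorEvent L ⊆ (⋃ x : {x : Space n // x ∈ L ∧ x ≠ 0},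
      {z | ‖(x : Space n)‖ ^ 2 ≤ 2 * inner ℝ z (x : Space n)} ∩ Metric.closedBall 0 R) ∪
      (Metric.closedBall 0 R)ᶜ := by
    rintro z ⟨x, hxL, hx, hz⟩
    by_cases hR : z ∈ Metric.closedBall 0 R
    · exact Or.inl (mem_iUnion.2 ⟨⟨x, hxL, hx⟩, (norm_sub_le_norm_iff z x).1 hz, hR⟩)
    · exact Or.inr hR
  refine (measure_mono hsub).trans ((measure_union_le _ _).trans (add_le_add_left ?_ _))
  calc _ ≤ ∑' x : {x : Space n // x ∈ L ∧ x ≠ 0}, noise n σ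
        ({z | ‖(x : Space n)‖ ^ 2 ≤ 2 * inner ℝ z (x : Space n)} ∩ Metric.closedBall 0 R) :=
        measure_iUnion_le _
    _ = ∑' x : {x : Space n // x ∈ L ∧ x ≠ 0}, ∫⁻ z in Metric.closedBall (0 : Space n) R,
        (Iic (2 * inner ℝ z e)).indicator 1 ‖(x : Space n)‖ ∂(noise n σ) := by
        congr 1 with x
        have hm : MeasurableSet {z : Space n | ‖(x : Space n)‖ ≤ 2 * inner ℝ z e} :=
          measurableSet_le (by fun_prop) (by fun_prop)
        rw [noise_halfspace_eq σ R he x.2.2, ← Measure.restrict_apply hm,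
          ← lintegral_indicator_one hm]
        rfl
    _ = ∫⁻ z in Metric.closedBall (0 : Space n) R, countLE L (2 * inner ℝ z e)
        ∂(noise n σ) := by
        rw [← lintegral_tsum]
        · rfl
        · intro x
          have hm : MeasurableSet {z : Space n | ‖(x : Space n)‖ ≤ 2 * inner ℝ z e} :=
            measurableSet_le (by fun_prop) (by fun_prop)
          exact ((measurable_one (α := ENNReal)).indicator hm).aemeasurable
    _ ≤ ∫⁻ z in Metric.closedBall (0 : Space n) R, ENNReal.ofReal c *
        volume (Metric.closedBall (0 : Space n) (2 * inner ℝ z e)) ∂(noise n σ) := by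
        refine lintegral_mono_ae ((ae_restrict_mem
          Metric.isClosed_closedBall.measurableSet).mono fun z hz => ?_)
        by_cases hz0 : 0 < inner ℝ z e
        -- Truncating to ‖z‖ ≤ R is why counts up to norm 2R suffice.
        · have hle : inner ℝ z e ≤ R := by
            have := real_inner_le_norm z e
            rw [he, mul_one] at this
            exact this.trans (by simpa using hz)
          refine (h (2 * inner ℝ z e) ⟨by linarith, by linarith⟩).trans ?_
          rw [volume_closedBall n 0 (by linarith), ← ENNReal.ofReal_mul hc, mul_assoc]
        · have : countLE L (2 * inner ℝ z e) = 0 := by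
            rw [countLE, ENNReal.tsum_eq_zero]
            intro x
            rw [indicator_of_notMem]
            have := norm_pos_iff.2 x.2.2
            rw [mem_Iic]
            linarith
          rw [this]
          exact zero_le
    _ ≤ _ := by
        rw [lintegral_const_mul' _ _ ENNReal.ofReal_ne_top]
        simp_rw [ENNReal.ofReal_mul hc]
        rw [lintegral_const_mul' _ _ ENNReal.ofReal_ne_top]
        refine mul_le_mul_right ?_ _
        exact lintegral_volume_closedBall_le σ R he

/-- If the lattice has at most `(ρ / R) ^ n` nonzero points of norm `ρ ≤ 2R`, then decoding fails
with probability at most `E[min(1, (‖z‖ / R) ^ n)]`. -/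
lemma noise_errorEvent_le_lintegral_min {n : ℕ} (L : Submodule ℤ (Space n)) [DiscreteTopology L]
    [IsZLattice ℝ L] (hn : 0 < n) (σ : ℝ) {R c : ℝ} (hR : 0 < R) (hc : 0 ≤ c)
    (h : CountBound L (2 * R) c) (hcR : c * ballVol n * R ^ n ≤ 1) :
    noise n σ (errorEvent L) ≤
      ∫⁻ z, ENNReal.ofReal (min 1 ((‖z‖ / R) ^ n)) ∂(noise n σ) := by
  refine (noise_errorEvent_le L hn σ hc h).trans ?_
  have hm : MeasurableSet (Metric.closedBall (0 : Space n) R) :=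
    Metric.isClosed_closedBall.measurableSet
  rw [← lintegral_add_compl (fun z => ENNReal.ofReal (min 1 ((‖z‖ / R) ^ n))) hm]
  apply add_le_add
  · refine lintegral_mono_ae ((ae_restrict_mem hm).mono fun z hz => ?_)
    rw [mem_closedBall_zero_iff] at hz
    apply ENNReal.ofReal_le_ofReal
    rw [min_eq_right (pow_le_one₀ (by positivity) ((div_le_one hR).2 hz)), div_pow,
      le_div_iff₀ (by positivity)]
    have : 0 ≤ ‖z‖ ^ n := by positivity
    nlinarith
  · rw [← setLIntegral_one]
    refine lintegral_mono_ae ((ae_restrict_mem hm.compl).mono fun z hz => ?_)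
    rw [mem_compl_iff, mem_closedBall_zero_iff, not_le] at hz
    rw [min_eq_left (one_le_pow₀ ((one_le_div hR).2 hz.le))]
    simp

/-! ### Asymptotics of the volume of the unit ball -/

lemma ballVol_eq {n : ℕ} (hn : 0 < n) :
    ballVol n = √Real.pi ^ n / Real.Gamma (n / 2 + 1) := by
  have : Nonempty (Fin n) := ⟨⟨0, hn⟩⟩
  rw [ballVol, EuclideanSpace.volume_ball]
  simp only [ENNReal.ofReal_one, one_pow, one_mul, Fintype.card_fin]
  exact ENNReal.toReal_ofReal (div_nonneg (by positivity) (Real.Gamma_pos_of_pos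
    (by positivity)).le)

lemma tendsto_log_natCast_div : Tendsto (fun n : ℕ => Real.log n / n) atTop (𝓝 0) :=
  Real.isLittleO_log_id_atTop.tendsto_div_nhds_zero.comp tendsto_natCast_atTop_atTop

lemma tendsto_log_factorial_div :
    Tendsto (fun n : ℕ => Real.log n.factorial / n - Real.log n) atTop (𝓝 (-1)) := by
  have h1 : Tendsto (fun n : ℕ => Real.log (Stirling.stirlingSeq n)) atTop
      (𝓝 (Real.log √Real.pi)) :=
    Stirling.tendsto_stirlingSeq_sqrt_pi.log (by positivity)
  have h2 : Tendsto (fun n : ℕ => -1 + (Real.log (Stirling.stirlingSeq n) / n +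
      1 / 2 * (Real.log 2 / n + Real.log n / n))) atTop (𝓝 (-1 + (0 + 1 / 2 * (0 + 0)))) :=
    tendsto_const_nhds.add ((h1.div_atTop tendsto_natCast_atTop_atTop).add
      (((tendsto_const_div_atTop_nhds_zero_nat _).add tendsto_log_natCast_div).const_mul _))
  simp only [add_zero, mul_zero] at h2
  refine h2.congr' ((eventually_gt_atTop 0).mono fun n hn => ?_)
  have hn' : (0 : ℝ) < n := by exact_mod_cast hn
  rw [Stirling.log_stirlingSeq_formula, Real.log_mul two_ne_zero hn'.ne',
    Real.log_div hn'.ne' (Real.exp_pos 1).ne', Real.log_exp]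
  field_simp
  ring

/-- Legendre duplication gives Γ((n+1)/2) Γ(n/2+1) = n! 2^{-n} √π. The two factors agree up to a
factor n, so Stirling for n! determines each on this scale. -/
lemma tendsto_log_Gamma_div :
    Tendsto (fun n : ℕ => 2 / (n : ℝ) * Real.log (Real.Gamma (n / 2 + 1)) - Real.log n) atTop
      (𝓝 (-1 - Real.log 2)) := by
  have h1 : Tendsto (fun n : ℕ => (Real.log n.factorial / n - Real.log n) - Real.log 2 +
      Real.log √Real.pi / n) atTop (𝓝 (-1 - Real.log 2 + 0)) :=
    (tendsto_log_factorial_div.sub_const _).add (tendsto_const_div_atTop_nhds_zero_nat _)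
  have h2 : Tendsto (fun n : ℕ => ((Real.log n.factorial / n - Real.log n) - Real.log 2 +
      Real.log √Real.pi / n) + Real.log n / n) atTop (𝓝 (-1 - Real.log 2 + 0 + 0)) :=
    h1.add tendsto_log_natCast_div
  simp only [add_zero] at h1 h2
  -- For n ≥ 3 the arguments lie in [2, ∞), where Γ is increasing.
  have key : ∀ n : ℕ, 3 ≤ n → ∃ a b : ℝ, a = Real.log (Real.Gamma (n / 2 + 1)) ∧
      a + b = Real.log n.factorial - n * Real.log 2 + Real.log √Real.pi ∧ b ≤ a ∧
      a ≤ b + Real.log n := by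
    intro n hn
    have hn' : (3 : ℝ) ≤ n := by exact_mod_cast hn
    have hs : (0 : ℝ) < (n + 1) / 2 := by positivity
    have g1 : 0 < Real.Gamma ((n + 1) / 2) := Real.Gamma_pos_of_pos hs
    have g2 : 0 < Real.Gamma ((n : ℝ) / 2 + 1) := Real.Gamma_pos_of_pos (by positivity)
    refine ⟨_, Real.log (Real.Gamma ((n + 1) / 2)), rfl, ?_, ?_, ?_⟩
    · have h := Real.Gamma_mul_Gamma_add_half ((n + 1) / 2)
      have e1 : ((n : ℝ) + 1) / 2 + 1 / 2 = n / 2 + 1 := by ring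
      have e2 : 2 * (((n : ℝ) + 1) / 2) = n + 1 := by ring
      have e3 : (1 : ℝ) - (n + 1) = -n := by ring
      rw [e1, e2, e3, Real.Gamma_nat_eq_factorial, Real.rpow_neg two_pos.le,
        Real.rpow_natCast] at h
      have hf : (0 : ℝ) < n.factorial := by exact_mod_cast n.factorial_pos
      rw [add_comm, ← Real.log_mul g1.ne' g2.ne', h, Real.log_mul (by positivity) (by positivity),
        Real.log_mul (by positivity) (by positivity), Real.log_inv, Real.log_pow]
      ring
    · apply Real.log_le_log g1
      apply Real.Gamma_strictMonoOn_Ici.monotoneOn <;> try rw [mem_Ici]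
      all_goals linarith
    · rw [← Real.log_mul g1.ne' (by positivity)]
      apply Real.log_le_log g2
      calc Real.Gamma ((n : ℝ) / 2 + 1) ≤ Real.Gamma (((n : ℝ) + 1) / 2 + 1) := by
            apply Real.Gamma_strictMonoOn_Ici.monotoneOn <;> try rw [mem_Ici]
            all_goals linarith
        _ = (n + 1) / 2 * Real.Gamma ((n + 1) / 2) := Real.Gamma_add_one hs.ne'
        _ ≤ _ := by
            rw [mul_comm]
            apply mul_le_mul_of_nonneg_left _ g1.le
            linarith
  refine tendsto_of_tendsto_of_tendsto_of_le_of_le' h1 h2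
    ((eventually_ge_atTop 3).mono fun n hn => ?_) ((eventually_ge_atTop 3).mono fun n hn => ?_) <;>
  · obtain ⟨a, b, ha, hab, hba, hab'⟩ := key n hn
    have hn' : (0 : ℝ) < n := by exact_mod_cast (by omega : 0 < n)
    rw [← ha]
    have e1 : (Real.log n.factorial / n - Real.log n) - Real.log 2 + Real.log √Real.pi / n =
        (a + b) / n - Real.log n := by
      rw [hab]; field_simp; ring
    have e2 : 2 / (n : ℝ) * a = (2 * a) / n := by ring
    simp only [e1, e2]
    first
    | linarith [div_le_div_of_nonneg_right (show a + b ≤ 2 * a by linarith) hn'.le]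
    | have := div_le_div_of_nonneg_right (show 2 * a ≤ (a + b) + Real.log n by linarith) hn'.le
      rw [add_div (a + b)] at this
      linarith

lemma tendsto_log_ballVol :
    Tendsto (fun n : ℕ => 2 / (n : ℝ) * Real.log (ballVol n) + Real.log n) atTop
      (𝓝 (Real.log (2 * Real.pi * Real.exp 1))) := by
  have h := (tendsto_log_Gamma_div.neg).const_add (Real.log Real.pi)
  have e : Real.log Real.pi + -(-1 - Real.log 2) = Real.log (2 * Real.pi * Real.exp 1) := by
    rw [Real.log_mul (by positivity) (by positivity), Real.log_mul (by positivity) (by positivity),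
      Real.log_exp]
    ring
  rw [e] at h
  refine h.congr' ((eventually_gt_atTop 0).mono fun n hn => ?_)
  have hn' : (0 : ℝ) < n := by exact_mod_cast hn
  beta_reduce
  rw [ballVol_eq hn, Real.log_div (by positivity) (Real.Gamma_pos_of_pos (by positivity)).ne',
    Real.log_pow, Real.log_sqrt Real.pi_pos.le]
  field_simp
  ring

/-! ### Admissible radii -/

instance isProbabilityMeasure_noiseNorm (n : ℕ) (σ : ℝ) : IsProbabilityMeasure (noiseNorm n σ) :=
  Measure.isProbabilityMeasure_map (by fun_prop)

lemma noiseNorm_Ioc_pos {n : ℕ} (hn : 0 < n) {σ : ℝ} (hσ : 0 < σ) {a b : ℝ} (ha : 0 ≤ a)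
    (hab : a < b) : 0 < (noiseNorm n σ).real (Ioc a b) := by
  have := isOpenPosMeasure_noise n hσ
  have hopen : IsOpen ((fun z : Space n => ‖z‖) ⁻¹' Ioo a b) := isOpen_Ioo.preimage continuous_norm
  have hne : ((fun z : Space n => ‖z‖) ⁻¹' Ioo a b).Nonempty := by
    refine ⟨EuclideanSpace.single (⟨0, hn⟩ : Fin n) ((a + b) / 2), ?_⟩
    simp only [mem_preimage, PiLp.norm_single, Real.norm_eq_abs]
    rw [abs_of_nonneg (by linarith)]
    constructor <;> linarith
  refine ENNReal.toReal_pos ?_ (measure_ne_top _ _)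
  rw [noiseNorm, Measure.map_apply continuous_norm.measurable measurableSet_Ioc]
  exact ((hopen.measure_pos _ hne).trans_le
    (measure_mono (preimage_mono Ioo_subset_Ioc_self))).ne'

lemma integrableOn_pow_noiseNorm (n : ℕ) (σ a b : ℝ) :
    IntegrableOn (fun ρ : ℝ => ρ ^ n) (Ioc a b) (noiseNorm n σ) :=
  (Continuous.integrableOn_Icc (by fun_prop)).mono_set Ioc_subset_Icc_self

section

variable {n : ℕ} (L : Submodule ℤ (Space n)) [DiscreteTopology L] [IsZLattice ℝ L]

/-- A minimizer of the bound is at least the terminal radius for its own factor. -/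
lemma one_le_of_isMinOn (hn : 0 < n) {σ : ℝ} (hσ : 0 < σ) {r : ℝ} (hr : 0 < r)
    (hmin : IsMinOn (dmhsBound L σ) (Ioi 0) r) :
    1 ≤ alphaOpt L r * density L * ballVol n * r ^ n := by
  set K := alphaOpt L r * density L * ballVol n with hK
  have hV := ballVol_pos n
  have hβ := density_pos L
  have hK0 : 0 ≤ K := by have := alphaOpt_nonneg L r; positivity
  -- It suffices to get 1 ≤ K r'^n for r' slightly above r. There α has not increased, so minimality
  -- forces the gain K ∫ ρ^n over (r, r'] to be at least the mass of (r, r'], which is positive.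
  have hlim : Tendsto (fun r' => K * r' ^ n) (𝓝[>] r) (𝓝 (K * r ^ n)) :=
    (Continuous.tendsto (by fun_prop) r).mono_left nhdsWithin_le_nhds
  refine ge_of_tendsto hlim ?_
  filter_upwards [eventually_alphaOpt_le L hn hr, self_mem_nhdsWithin] with r' hα hr'
  have hr' : r < r' := hr'
  have hm := hmin (mem_Ioi.2 (hr.trans hr'))
  simp only [mem_ofPred_eq, dmhsBound, ← hK, ← Measure.real_def] at hm
  have hu : Ioc 0 r' = Ioc 0 r ∪ Ioc r r' := (Ioc_union_Ioc_eq_Ioc hr.le hr'.le).symm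
  have hint : ∫ ρ in Ioc 0 r', ρ ^ n ∂(noiseNorm n σ) =
      ∫ ρ in Ioc 0 r, ρ ^ n ∂(noiseNorm n σ) + ∫ ρ in Ioc r r', ρ ^ n ∂(noiseNorm n σ) := by
    rw [hu, setIntegral_union (Ioc_disjoint_Ioc_of_le le_rfl) measurableSet_Ioc
      (integrableOn_pow_noiseNorm _ _ _ _) (integrableOn_pow_noiseNorm _ _ _ _)]
  have hmass : (noiseNorm n σ).real (Ioi r) =
      (noiseNorm n σ).real (Ioc r r') + (noiseNorm n σ).real (Ioi r') := by
    rw [← Ioc_union_Ioi_eq_Ioi hr'.le, measureReal_union _ measurableSet_Ioi]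
    rw [disjoint_left]
    exact fun x hx hx' => not_lt.2 hx.2 hx'
  have hpos := noiseNorm_Ioc_pos hn hσ hr.le hr'
  have hnn : 0 ≤ ∫ ρ in Ioc 0 r', ρ ^ n ∂(noiseNorm n σ) :=
    setIntegral_nonneg measurableSet_Ioc fun x hx => pow_nonneg hx.1.le n
  have hle : ∫ ρ in Ioc r r', ρ ^ n ∂(noiseNorm n σ) ≤
      (noiseNorm n σ).real (Ioc r r') * r' ^ n := by
    rw [← smul_eq_mul, ← setIntegral_const]
    refine setIntegral_mono_on (integrableOn_pow_noiseNorm _ _ _ _) (by simp) measurableSet_Ioc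
      fun x hx => pow_le_pow_left₀ (hr.le.trans hx.1.le) hx.2 n
  have hαK : alphaOpt L r' * density L * ballVol n ≤ K := by rw [hK]; gcongr
  have h1 := hm.trans (add_le_add_left (mul_le_mul_of_nonneg_right hαK hnn) _)
  rw [hint, hmass] at h1
  have h2 := mul_le_mul_of_nonneg_left hle hK0
  by_contra! hlt
  nlinarith

/-- The `max` with 1 serves the third kind of radius, which is bounded below without α. -/
lemma one_le_of_isBoundRadius (hn : 0 < n) {σ : ℝ} (hσ : 0 < σ) {r : ℝ}
    (h : IsBoundRadius L σ r) :
    1 ≤ max 1 (alphaOpt L r) * density L * ballVol n * r ^ n := by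
  obtain ⟨hr, h⟩ := h
  have hV := ballVol_pos n
  have hβ := density_pos L
  have hn' : (n : ℝ) ≠ 0 := by positivity
  have hα := alphaOpt_nonneg L r
  have mono : ∀ a, a ≤ max 1 (alphaOpt L r) → 1 ≤ a * density L * ballVol n * r ^ n →
      1 ≤ max 1 (alphaOpt L r) * density L * ballVol n * r ^ n := fun a ha h => by
    refine h.trans ?_
    gcongr
  have hpow : ∀ x : ℝ, 0 < x → (x ^ (-(1 / (n : ℝ)))) ^ n = x⁻¹ := fun x hx => by
    rw [← Real.rpow_mul_natCast hx.le, neg_mul, one_div_mul_cancel hn', Real.rpow_neg_one]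
  rcases h with h | h | h
  · exact mono _ (le_max_right _ _) (one_le_of_isMinOn L hn hσ hr h)
  · refine mono _ (le_max_right _ _) ?_
    have hx : 0 < alphaOpt L r * density L * ballVol n := by
      -- If α were 0, the real power would be 0 by convention, against r > 0.
      refine lt_of_le_of_ne (by positivity) fun h0 => ?_
      rw [← h0, Real.zero_rpow (by simpa using hn')] at h
      exact hr.ne' h
    have h2 := congrArg (· ^ n) h
    simp only [hpow _ hx] at h2
    rw [h2, mul_inv_cancel₀ hx.ne']
  · refine mono 1 (le_max_left _ _) ?_
    have hx : 0 < density L * ballVol n := by positivity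
    have h2 := pow_le_pow_left₀ (by positivity) h n
    rw [hpow _ hx, inv_le_iff_one_le_mul₀ hx] at h2
    linarith

/-! ### The Chernoff bound -/

/-- The Chernoff bound for `min(1, (‖z‖ / R) ^ n)`. -/
lemma lintegral_min_le (hn : 0 < n) {σ R θ c : ℝ} (hσ : 0 < σ) (hR : 0 < R)
    (hθ : θ < R ^ 2 / (n * σ ^ 2)) (hK : ∀ y, 0 < y → min 0 (Real.log y) ≤ θ * y - c) :
    ∫⁻ z, ENNReal.ofReal (min 1 ((‖z‖ / R) ^ n)) ∂(noise n σ) ≤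
      ENNReal.ofReal (Real.exp (-(n : ℝ) *
        ((c + Real.log (1 - θ / (R ^ 2 / (n * σ ^ 2)))) / 2))) := by
  have hn' : (0 : ℝ) < n := by exact_mod_cast hn
  set u := R ^ 2 / (n * σ ^ 2) with hu
  have hu0 : 0 < u := by positivity
  -- With y = (‖z‖/R)², this gives s‖z‖² = (n/2) θ y, so `hK` multiplied by n/2 is the exponent of
  -- the pointwise bound.
  set s := n * θ / (2 * R ^ 2) with hs
  have hsu : 2 * s * σ ^ 2 = θ / u := by rw [hs, hu]; field_simp
  have hs1 : 2 * s * σ ^ 2 < 1 := by rwa [hsu, div_lt_one hu0]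
  have hpt : ∀ z : Space n, min 1 ((‖z‖ / R) ^ n) ≤
      Real.exp (-(n * c / 2)) * Real.exp (s * ‖z‖ ^ 2) := by
    intro z
    rcases eq_or_ne z 0 with rfl | hz
    · refine (min_le_right _ _).trans ?_
      rw [norm_zero, zero_div, zero_pow hn.ne']
      positivity
    have hz0 : 0 < ‖z‖ := norm_pos_iff.2 hz
    have ht : 0 < ‖z‖ / R := by positivity
    have h := hK ((‖z‖ / R) ^ 2) (by positivity)
    rw [Real.log_pow] at h
    have h2 : s * ‖z‖ ^ 2 = n / 2 * (θ * (‖z‖ / R) ^ 2) := by rw [hs]; field_simp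
    rw [← Real.exp_add, h2]
    rcases min_le_iff.1 h with h | h
    · refine (min_le_left _ _).trans (Real.one_le_exp ?_)
      nlinarith
    · refine (min_le_right _ _).trans ?_
      rw [← Real.exp_log (pow_pos ht n), Real.log_pow]
      apply Real.exp_le_exp.2
      push_cast at h
      nlinarith
  calc _ ≤ ∫⁻ z, ENNReal.ofReal (Real.exp (-(n * c / 2))) *
        ENNReal.ofReal (Real.exp (s * ‖z‖ ^ 2)) ∂(noise n σ) := by
        refine lintegral_mono fun z => ?_
        rw [← ENNReal.ofReal_mul (Real.exp_pos _).le]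
        exact ENNReal.ofReal_le_ofReal (hpt z)
    _ = _ := by
        rw [lintegral_const_mul' _ _ ENNReal.ofReal_ne_top,
          lintegral_exp_norm_sq_noise n hσ hs1, ← ENNReal.ofReal_mul (Real.exp_pos _).le, hsu]
        have h1 : 0 < 1 - θ / u := by rw [← hsu]; linarith
        congr 1
        rw [← Real.exp_log (show 0 < √(1 / (1 - θ / u)) ^ n by positivity), ← Real.exp_add,
          Real.log_pow, Real.log_sqrt (by positivity), one_div, Real.log_inv]
        congr 1
        ring

/-- The squared radius `(max(1, α) β V_n)^{-2/n}`, normalized by `n σ²`. -/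
noncomputable def radiusRatio (σ : ℝ) (r : ℝ) : ℝ :=
  Real.exp (-(2 / (n : ℝ) * Real.log (max 1 (alphaOpt L r) * density L * ballVol n))) /
    (n * σ ^ 2)

lemma errorProb_le (hn : 0 < n) {σ r θ c : ℝ} (hσ : 0 < σ) (h : IsBoundRadius L σ r)
    (hθ : θ < radiusRatio L σ r)
    (hK : ∀ y, 0 < y → min 0 (Real.log y) ≤ θ * y - c) :
    errorProb L σ ≤ Real.exp (-(n : ℝ) *
      ((c + Real.log (1 - θ / radiusRatio L σ r)) / 2)) := by
  have hV := ballVol_pos n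
  have hβ := density_pos L
  have hα := alphaOpt_nonneg L r
  have hn' : (0 : ℝ) < n := by exact_mod_cast hn
  set x := max 1 (alphaOpt L r) * density L * ballVol n with hx
  have hx0 : 0 < x := by positivity
  set R := Real.exp (-(Real.log x / n)) with hR
  have hR0 : 0 < R := Real.exp_pos _
  have hRn : R ^ n = x⁻¹ := by
    rw [hR, ← Real.exp_nat_mul, mul_neg, mul_div_cancel₀ _ hn'.ne', Real.exp_neg,
      Real.exp_log hx0]
  have hRr : R ≤ r := by
    have h1 := one_le_of_isBoundRadius L hn hσ h
    refine le_of_pow_le_pow_left₀ hn.ne' h.1.le ?_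
    rwa [hRn, inv_le_iff_one_le_mul₀' hx0]
  have hcb : CountBound L (2 * R) (alphaOpt L r * density L) := fun ρ hρ =>
    countBound_alphaOpt L hn h.1 ρ ⟨hρ.1, hρ.2.trans (by linarith)⟩
  have hcR : alphaOpt L r * density L * ballVol n * R ^ n ≤ 1 := by
    rw [hRn, ← div_eq_mul_inv, div_le_one hx0, hx]
    gcongr
    exact le_max_right _ _
  have hru : radiusRatio L σ r = R ^ 2 / (n * σ ^ 2) := by
    rw [radiusRatio, ← hx, hR, ← Real.exp_nat_mul]
    congr 2
    push_cast
    ring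
  rw [hru] at hθ ⊢
  exact ENNReal.toReal_le_of_le_ofReal (Real.exp_pos _).le
    ((noise_errorEvent_le_lintegral_min L hn σ hR0 (by positivity) hcb hcR).trans
      (lintegral_min_le hn hσ hR0 hθ hK))

end

/-! ### The limiting exponent -/

lemma tendsto_radiusRatio {σ : ℝ} (hσ : 0 < σ) {δ : ℝ} {d : ℕ → ℕ} (hd_pos : ∀ k, 0 < d k)
    (hd : Tendsto d atTop atTop) (Λ : ∀ k, Submodule ℤ (Space (d k)))
    [∀ k, DiscreteTopology (Λ k)] [∀ k, IsZLattice ℝ (Λ k)] (hδ : ∀ k, nld (Λ k) = δ)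
    {r : ℕ → ℝ}
    (hα : Tendsto (fun k => 1 / (d k : ℝ) * Real.log (alphaOpt (Λ k) (r k))) atTop (𝓝 0)) :
    Tendsto (fun k => radiusRatio (Λ k) σ (r k)) atTop
      (𝓝 (Real.exp (2 * (deltaStar σ - δ)))) := by
  have hA : Tendsto (fun k => 1 / (d k : ℝ) * Real.log (max 1 (alphaOpt (Λ k) (r k)))) atTop
      (𝓝 0) := by
    have h := hα.max (tendsto_const_nhds (x := (0 : ℝ)))
    rw [max_self] at h
    refine h.congr fun k => ?_
    have hα0 := alphaOpt_nonneg (Λ k) (r k)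
    rcases le_total (alphaOpt (Λ k) (r k)) 1 with h1 | h1
    · rw [max_eq_left h1, Real.log_one, mul_zero]
      exact max_eq_right (mul_nonpos_of_nonneg_of_nonpos (by positivity)
        (Real.log_nonpos hα0 h1))
    · rw [max_eq_right h1]
      exact max_eq_left (mul_nonneg (by positivity) (Real.log_nonneg h1))
  have hV := tendsto_log_ballVol.comp hd
  have hlim := (((hA.const_mul (-2)).sub hV).sub_const (2 * δ + Real.log (σ ^ 2))).rexp
  have e : -2 * 0 - Real.log (2 * Real.pi * Real.exp 1) - (2 * δ + Real.log (σ ^ 2)) =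
      2 * (deltaStar σ - δ) := by
    rw [deltaStar, one_div, one_div, Real.log_inv,
      Real.log_mul (x := 2 * Real.pi * Real.exp 1) (by positivity) (by positivity)]
    ring
  rw [e] at hlim
  refine hlim.congr fun k => ?_
  have hn : (0 : ℝ) < d k := by exact_mod_cast hd_pos k
  have hVk := ballVol_pos (d k)
  have hβ := density_pos (Λ k)
  have hA0 : 0 < max 1 (alphaOpt (Λ k) (r k)) := lt_max_of_lt_left one_pos
  have hlogβ : Real.log (density (Λ k)) = d k * δ := by
    rw [← hδ k, nld, mul_div_cancel₀ _ hn.ne']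
  rw [radiusRatio, Real.log_mul (by positivity) (by positivity),
    Real.log_mul (by positivity) (by positivity), hlogβ,
    ← Real.exp_log (show (0 : ℝ) < d k * σ ^ 2 by positivity), ← Real.exp_sub,
    Real.log_mul (by positivity) (by positivity), Function.comp_apply]
  congr 1
  field_simp
  ring

lemma deltaCr_eq {σ : ℝ} (hσ : 0 < σ) : deltaCr σ = deltaStar σ - Real.log 2 / 2 := by
  rw [deltaCr, deltaStar, one_div (4 * _ * _ * _), one_div (2 * _ * _ * _), Real.log_inv,
    Real.log_inv,
    show 4 * Real.pi * Real.exp 1 * σ ^ 2 = 2 * (2 * Real.pi * Real.exp 1 * σ ^ 2) by ring,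
    Real.log_mul two_ne_zero (by positivity)]
  ring

/-- The random coding exponent as the value of a Chernoff bound. -/
lemma exists_chernoff_parameters {σ : ℝ} (hσ : 0 < σ) (δ : ℝ) :
    ∃ θ c : ℝ, θ < Real.exp (2 * (deltaStar σ - δ)) ∧
      (∀ y, 0 < y → min 0 (Real.log y) ≤ θ * y - c) ∧
      (c + Real.log (1 - θ / Real.exp (2 * (deltaStar σ - δ)))) / 2 =
        randomCodingExponent σ δ := by
  set x := 2 * (deltaStar σ - δ) with hx
  have hu := Real.exp_pos x
  have hcr := deltaCr_eq hσ
  rw [randomCodingExponent]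
  split_ifs with h1 h2
  · have hx2 : Real.log 2 ≤ x := by linarith
    have hu2 : 2 ≤ Real.exp x := by
      rw [← Real.exp_log two_pos]
      exact Real.exp_le_exp.2 hx2
    have hθ : 0 < Real.exp x / 2 := by positivity
    -- The tangent to log at y = 2/u ≤ 1, where u = e^x; θ = u/2 maximizes 1 + log θ + log(1 - θ/u).
    refine ⟨Real.exp x / 2, 1 + Real.log (Real.exp x / 2), by linarith, fun y hy => ?_, ?_⟩
    · refine (min_le_right _ _).trans ?_
      have := Real.log_le_sub_one_of_pos (mul_pos hθ hy)
      rw [Real.log_mul hθ.ne' hy.ne'] at this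
      linarith
    · have e : 1 - Real.exp x / 2 / Real.exp x = 2⁻¹ := by field_simp; norm_num
      rw [e, Real.log_inv, Real.log_div hu.ne' two_ne_zero, Real.log_exp,
        Real.log_div (Real.exp_pos 1).ne' four_ne_zero, Real.log_exp,
        show (4 : ℝ) = 2 ^ 2 by norm_num, Real.log_pow]
      push_cast
      linarith
  · have hx0 : 0 < x := by linarith
    have hu1 : 1 ≤ Real.exp x := Real.one_le_exp hx0.le
    have hu2 : Real.exp x ≤ 2 := by
      rw [← Real.exp_log two_pos]
      exact Real.exp_le_exp.2 (by linarith [not_le.1 h1])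
    -- Now 2/u ≥ 1, so the line passes through the corner (1, 0) of min(0, log y), with slope u - 1
    -- in [0, 1].
    refine ⟨Real.exp x - 1, Real.exp x - 1, by linarith, fun y hy => ?_, ?_⟩
    · rcases le_total 1 y with hy1 | hy1
      · refine (min_le_left _ _).trans ?_
        nlinarith
      · refine (min_le_right _ _).trans ((Real.log_le_sub_one_of_pos hy).trans ?_)
        nlinarith
    · have e : 1 - (Real.exp x - 1) / Real.exp x = (Real.exp x)⁻¹ := by field_simp; ring
      rw [e, Real.log_inv, Real.log_exp]
      ring
  · exact ⟨0, 0, hu, fun y _ => by simp, by simp⟩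

end LatticeExponent

theorem mainTheorem11
    (σ : ℝ) (hσ : 0 < σ) (δ : ℝ)
    (d : ℕ → ℕ) (hd_pos : ∀ k, 0 < d k) (hd : Tendsto d atTop atTop)
    (Λ : ∀ k, Submodule ℤ (LatticeExponent.Space (d k)))
    [∀ k, DiscreteTopology (Λ k)] [∀ k, IsZLattice ℝ (Λ k)]
    (hδ : ∀ k, LatticeExponent.nld (Λ k) = δ)
    (r : ℕ → ℝ) (hr : ∀ k, LatticeExponent.IsBoundRadius (Λ k) σ (r k))
    (hα : Tendsto
      (fun k => 1 / (d k : ℝ) * Real.log (LatticeExponent.alphaOpt (Λ k) (r k)))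
      atTop (𝓝 0)) :
    ∃ ε : ℕ → ℝ, Tendsto ε atTop (𝓝 0) ∧
      ∀ k, LatticeExponent.errorProb (Λ k) σ ≤
        Real.exp (-(d k : ℝ) * (LatticeExponent.randomCodingExponent σ δ + ε k)) := by
  open LatticeExponent in
  obtain ⟨θ, c, hθ, hK, hE⟩ := exists_chernoff_parameters hσ δ
  have hu := tendsto_radiusRatio hσ hd_pos hd Λ hδ hα
  set u := Real.exp (2 * (deltaStar σ - δ))
  have hu0 : 0 < u := Real.exp_pos _
  have hE' : Tendsto (fun k => (c + Real.log (1 - θ / radiusRatio (Λ k) σ (r k))) / 2) atTop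
      (𝓝 (randomCodingExponent σ δ)) := by
    rw [← hE]
    refine ((((tendsto_const_nhds.div hu hu0.ne').const_sub 1).log ?_).const_add c).div_const 2
    exact (sub_pos.2 ((div_lt_one hu0).2 hθ)).ne'
  have hgood : ∀ᶠ k in atTop, θ < radiusRatio (Λ k) σ (r k) := hu.eventually_const_lt hθ
  classical
  -- Where the Chernoff bound is not yet available, ε = -E_r reduces the claim to P_e ≤ 1.
  refine ⟨fun k => if θ < radiusRatio (Λ k) σ (r k) then
    (c + Real.log (1 - θ / radiusRatio (Λ k) σ (r k))) / 2 - randomCodingExponent σ δ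
    else -randomCodingExponent σ δ, ?_, fun k => ?_⟩
  · have h := hE'.sub_const (randomCodingExponent σ δ)
    rw [sub_self] at h
    refine h.congr' (hgood.mono fun k hk => ?_)
    beta_reduce
    rw [if_pos hk]
  · beta_reduce
    split_ifs with hk
    · rw [add_sub_cancel]
      exact errorProb_le (Λ k) (hd_pos k) hσ (hr k) hk hK
    · rw [add_neg_cancel, mul_zero, Real.exp_zero]
      exact measureReal_le_one
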